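/- Let $n\ge 1$. Put $$\Lambda_n^{\dagger *}=\{\nu\in\mathbb Z^3:\ -n\le \nu_i\pm\nu_j\le n,\ 1\le i<j\le 3\},$$ and for $\nu\in\Lambda_n^{\dagger *}$ let $\mathbf h(\nu)=2\,(-\nu_1+\nu_2+\nu_3,\ \nu_1-\nu_2+\nu_3,\ \nu_1+\nu_2-\nu_3,\ -\nu_1-\nu_2-\nu_3)$. Let $I_\nu$ (respectively $J_\nu$) be the set of all $i$ (respectively $j$) in $\{1,2,3,4\}$ that occur in a pair $(i,j)$ with $h_i(\nu)-h_j(\nu)=4n$, and let $\mu_\nu=\binom{|I_\nu|+|J_\nu|}{|I_\nu|}^{-1}$. (So $\mu_\nu$ is $1$ at interior points of the rhombic dodecahedron, $\frac12$ inside its faces, $\frac13$ inside its edges, and $\frac14$ or $\frac16$ at its vertices.) Define $$\Phi_n^*(x)=\frac1{2n^3}\sum_{\nu\in\Lambda_n^{\dagger *}}\mu_\nu\, e^{2\pi i\,\nu\cdot x},\qquad \mathcal P g(x)=\frac18\sum_{\varepsilon\in\{-1,1\}^3} g(\varepsilon_1x_1,\varepsilon_2x_2,\varepsilon_3x_3),\qquad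 x\in\mathbb R^3 .$$ Let $$\Xi_n=\{2k: k\in\mathbb Z^3,\ 0\le k_1,k_2,k_3\le \tfrac n2\}\cup\{2k+(1,1,1): k\in\mathbb Z^3,\ 0\le k_1,k_2,k_3\le\tfrac{n-1}2\},$$ $z_k=(\cos\frac{k_1\pi}n,\cos\frac{k_2\pi}n,\cos\frac{k_3\pi}n)$ and $\Gamma_n=\{z_k:k\in\Xi_n\}\subset[-1,1]^3$. For $k\in\Xi_n$ let $\lambda_k=8,4,2,1$ according to whether $z_k$ is in the interior of the cube $[-1,1]^3$, inside one of its faces, inside one of its edges, or is a vertex. Put $$\ell_k(x)=\lambda_k\,\mathcal P\big[\Phi_n^*(\cdot-\tfrac k{2n})\big](x),\qquad x\in\mathbb R^3,\ k\in\Xi_n,$$ and define $\ell_k^*$ on $[-1,1]^3$ by $\ell^*_k(s)=\ell_k(x)$ where $s_i=\cos 2\pi x_i$ with $x_i\in[0,\frac12]$, $i=1,2,3$. For a function $f$ on $[-1,1]^3$ let $$\mathcal L_nf(s)=\sum_{k\in\Xi_n}f(z_k)\,\ell_k^*(s),\qquad s\in[-1,1]^3,$$ and let $\Pi_n^*=\mathrm{span}\{s_1^{m_1}s_2^{m_2}s_3^{m_3}:\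 m_1,m_2,m_3\ge0,\ m_i+m_j\le n\ \text{for}\ 1\le i<j\le3\}$. Then: 1. $|\Gamma_n|=(\lfloor\frac n2\rfloor+1)^3+(\lfloor\frac{n-1}2\rfloor+1)^3$, which is roughly $n^3/4$. 2. For every $k\in\Xi_n$, the identity $\ell_k^*(\cos2\pi x_1,\cos2\pi x_2,\cos2\pi x_3)=\ell_k(x)$ holds for all $x\in\mathbb R^3$. 3. For every complex-valued function $f$ on $[-1,1]^3$, $\mathcal L_nf$ is (the restriction to $[-1,1]^3$ of) a polynomial in $\Pi_n^*$, with complex coefficients, and $\mathcal L_nf(z)=f(z)$ for all $z\in\Gamma_n$. If $f$ is real-valued, the polynomial may be taken with real coefficients. -/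

import Mathlib

namespace CubeInterp

noncomputable section

/-- The closed index set `{k ∈ ℤ³ : -n ≤ k_ν ± k_μ ≤ n, ν < μ}`, i.e. the integer points of the
closed rhombic dodecahedron (the conditions force `|k_i| ≤ n`). -/
def LambdaDagStar (n : ℕ) : Finset (Fin 3 → ℤ) :=
  (Fintype.piFinset fun _ : Fin 3 => Finset.Icc (-(n : ℤ)) n).filter fun k =>
    ∀ i j : Fin 3, i < j →
      (-(n : ℤ) ≤ k i + k j ∧ k i + k j ≤ n) ∧ (-(n : ℤ) ≤ k i - k j ∧ k i - k j ≤ n)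

/-- Homogeneous coordinates of an index `k ∈ ℤ³`; they sum to zero. -/
def homog (k : Fin 3 → ℤ) : Fin 4 → ℤ :=
  ![2 * (-k 0 + k 1 + k 2), 2 * (k 0 - k 1 + k 2), 2 * (k 0 + k 1 - k 2),
    2 * (-k 0 - k 1 - k 2)]

/-- The indices `i` for which `k` lies on some closed face `j_i - j_l = 4n`. -/
def upperIdx (n : ℕ) (k : Fin 3 → ℤ) : Finset (Fin 4) :=
  Finset.univ.filter fun i => ∃ l, homog k i - homog k l = 4 * n

/-- The indices `l` for which `k` lies on some closed face `j_i - j_l = 4n`. -/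
def lowerIdx (n : ℕ) (k : Fin 3 → ℤ) : Finset (Fin 4) :=
  Finset.univ.filter fun l => ∃ i, homog k i - homog k l = 4 * n

/-- The boundary weight `μ_k`.  With `I = upperIdx n k` and `J = lowerIdx n k`, a boundary point `k`
of the dodecahedron lies in the relatively open boundary element `B_{I,J}` (on all the faces
`F_{i,j}`, `i ∈ I`, `j ∈ J`, and on no other face), and its weight is `1 / binom(|I|+|J|, |I|)`:
`1/2` inside faces, `1/3` inside edges, `1/4` or `1/6` at vertices.  For interior points `I` and `J`
are empty and the weight is `1`. -/
def mu (n : ℕ) (k : Fin 3 → ℤ) : ℂ :=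
  1 / (((upperIdx n k).card + (lowerIdx n k).card).choose (upperIdx n k).card : ℂ)

/-- The exponential `e_k(x) = exp(2πi k·x)`. -/
def expo (k : Fin 3 → ℤ) (x : Fin 3 → ℝ) : ℂ :=
  Complex.exp (2 * Real.pi * Complex.I * ∑ i, (k i : ℂ) * (x i : ℂ))

/-- The kernel `Φ_n^*`. -/
def PhiStar (n : ℕ) (x : Fin 3 → ℝ) : ℂ :=
  1 / (2 * (n : ℂ) ^ 3) * ∑ k ∈ LambdaDagStar n, mu n k * expo k x

/-- The symmetrization operator `𝒫`, the average over the sign changes of the coordinates. -/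
def symm (f : (Fin 3 → ℝ) → ℂ) (x : Fin 3 → ℝ) : ℂ :=
  1 / 8 * ∑ e ∈ Fintype.piFinset (fun _ : Fin 3 => ({-1, 1} : Finset ℤ)),
    f fun i => (e i : ℝ) * x i

/-- The index set `Ξ_n = {2k : 0 ≤ k_i ≤ n/2} ∪ {2k+1 : 0 ≤ k_i ≤ (n-1)/2}`. -/
def Xi (n : ℕ) : Finset (Fin 3 → ℤ) :=
  ((Fintype.piFinset fun _ : Fin 3 => Finset.Icc (0 : ℤ) ((n : ℤ) / 2)).image
      fun k i => 2 * k i) ∪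
    ((Fintype.piFinset fun _ : Fin 3 => Finset.Icc (0 : ℤ) (((n : ℤ) - 1) / 2)).image
      fun k i => 2 * k i + 1)

/-- The point `z_k = (cos(k₁π/n), cos(k₂π/n), cos(k₃π/n))`. -/
def node (n : ℕ) (k : Fin 3 → ℤ) : Fin 3 → ℝ :=
  fun i => Real.cos ((k i : ℝ) * Real.pi / n)

/-- The set of nodes `Γ_n = {z_k : k ∈ Ξ_n}`. -/
def Gamma (n : ℕ) : Set (Fin 3 → ℝ) :=
  node n '' (Xi n : Set (Fin 3 → ℤ))

/-- The cubature weight `λ_k`: `8`, `4`, `2` or `1` according to whether `k ∈ Ξ_n` is in the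
interior, inside a face, inside an edge or at a vertex of `[0,n]³`, equivalently whether `z_k` is
so placed in `[-1,1]³`; that is, `2` to the number of coordinates strictly between the ends. -/
def lam (n : ℕ) (k : Fin 3 → ℤ) : ℂ :=
  2 ^ (Finset.univ.filter fun i : Fin 3 => 0 < k i ∧ k i < n).card

/-- The trigonometric fundamental function `ℓ_k(x) = λ_k 𝒫[Φ_n^*(· - k/2n)](x)`. -/
def ell (n : ℕ) (k : Fin 3 → ℤ) (x : Fin 3 → ℝ) : ℂ :=
  lam n k * symm (fun y => PhiStar n fun i => y i - (k i : ℝ) / (2 * n)) x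

/-- The function `ℓ_k^*(s) = ℓ_k(x)` on `[-1,1]³`, where `x ∈ [0,1/2]³` is the solution of
`s_i = cos 2πx_i`. -/
def ellStar (n : ℕ) (k : Fin 3 → ℤ) (s : Fin 3 → ℝ) : ℂ :=
  ell n k fun i => Real.arccos (s i) / (2 * Real.pi)

/-- The interpolation operator `L_n f(s) = ∑_k f(z_k) ℓ_k^*(s)`. -/
def interp (n : ℕ) (f : (Fin 3 → ℝ) → ℂ) (s : Fin 3 → ℝ) : ℂ :=
  ∑ k ∈ Xi n, f (node n k) * ellStar n k s

/-- The space `Π_n^*` of polynomials with coefficients in `R`, spanned by the monomials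
`s₁^{m₁} s₂^{m₂} s₃^{m₃}` with `m_i + m_j ≤ n` for `i < j`. -/
def PiStar (R : Type*) [CommRing R] (n : ℕ) : Submodule R (MvPolynomial (Fin 3) R) :=
  Submodule.span R
    {p | ∃ m : Fin 3 →₀ ℕ, (∀ i j : Fin 3, i < j → m i + m j ≤ n) ∧
      p = MvPolynomial.monomial m 1}

end

end CubeInterp

namespace CubeInterp

/-! ### The half-open rhombic dodecahedra tile the lattice -/

/-! The weights make the closed dodecahedron act as a fundamental domain of the lattice nD₃. Break
the ties between opposite faces by an ordering `σ` of the four homogeneous coordinates: each of the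
24 resulting half-open dodecahedra is a transversal of ℤ³/nD₃ (`isTransversal_halfOpen`), and `mu n
k` is the fraction of them that keep `k` (`mu_eq_sum`). Hence the weighted sum of an nD₃-periodic
function equals its sum over an n × n × 2n box (`sum_mu_mul_of_periodic`).

At j/(2n) with all coordinates of j of one parity, the exponentials are periodic in the frequency.
The box sum then factors into geometric sums, and the kernel is 1 or 0 (`PhiStar_div`). Averaging
over signs also factors by coordinates, and `lam` compensates for sign changes that fix a node
modulo the period; this gives the interpolation property (`ell_div`).

Symmetrized exponentials are products of cosines, that is, of Chebyshev polynomials in s. Their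
degrees satisfy |k_i| + |k_j| ≤ n, so `interp` lands in `PiStar`. Central symmetry of the weights
makes the kernel real. -/

lemma mem_LambdaDagStar_iff {n : ℕ} {k : Fin 3 → ℤ} :
    k ∈ LambdaDagStar n ↔ ∀ i l, homog k i - homog k l ≤ 4 * n := by
  simp only [LambdaDagStar, Finset.mem_filter, Fintype.mem_piFinset, Finset.mem_Icc, homog,
    Fin.forall_fin_succ, Fin.isValue]
  simp
  omega

/-- Homogeneous coordinates perturbed so as to break ties according to `σ`. -/
def perturbed (σ : Equiv.Perm (Fin 4)) (k : Fin 3 → ℤ) (i : Fin 4) : ℤ :=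
  4 * homog k i + ((σ i : ℕ) : ℤ)

/-- The part of the closed dodecahedron that remains when ties are broken according to `σ`. -/
noncomputable def halfOpen (n : ℕ) (σ : Equiv.Perm (Fin 4)) : Finset (Fin 3 → ℤ) :=
  (LambdaDagStar n).filter fun k => ∀ i l, perturbed σ k i - perturbed σ k l < 16 * n

/-- The factor 4 in `perturbed` leaves room for the labels 0, …, 3: they decide ties and nothing
else. -/
lemma perturbed_sub_lt_iff {n : ℕ} (hn : 1 ≤ n) (σ : Equiv.Perm (Fin 4)) (k : Fin 3 → ℤ)
    (i l : Fin 4) :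
    perturbed σ k i - perturbed σ k l < 16 * n ↔
      homog k i - homog k l ≤ 4 * n ∧ (homog k i - homog k l = 4 * n → σ i < σ l) := by
  have hi := (σ i).isLt
  have hl := (σ l).isLt
  rw [Fin.lt_def]
  unfold perturbed
  by_cases h : (σ i : ℕ) = σ l
  · have : i = l := σ.injective (Fin.ext h)
    subst this
    omega
  · omega

lemma mem_halfOpen_iff {n : ℕ} (hn : 1 ≤ n) {σ : Equiv.Perm (Fin 4)} {k : Fin 3 → ℤ} :
    k ∈ halfOpen n σ ↔ ∀ i l, perturbed σ k i - perturbed σ k l < 16 * n := by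
  simp only [halfOpen, Finset.mem_filter, and_iff_right_iff_imp, mem_LambdaDagStar_iff]
  exact fun h i l => ((perturbed_sub_lt_iff hn σ k i l).1 (h i l)).1

/-- Of the equally likely ways in which a random ordering interleaves `I` and `J`, exactly one puts
all of `I` first. The finitely many cases are checked by evaluation. -/
lemma card_perm_mul_choose (I J : Finset (Fin 4)) (h : Disjoint I J) :
    (Finset.univ.filter fun σ : Equiv.Perm (Fin 4) => ∀ i ∈ I, ∀ l ∈ J, σ i < σ l).card *
      (I.card + J.card).choose I.card = 24 := by
  revert I J
  decide +kernel

lemma mem_halfOpen_iff_lt {n : ℕ} (hn : 1 ≤ n) {k : Fin 3 → ℤ} (hk : k ∈ LambdaDagStar n)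
    (σ : Equiv.Perm (Fin 4)) :
    k ∈ halfOpen n σ ↔ ∀ i ∈ upperIdx n k, ∀ l ∈ lowerIdx n k, σ i < σ l := by
  rw [mem_LambdaDagStar_iff] at hk
  simp only [mem_halfOpen_iff hn, perturbed_sub_lt_iff hn, upperIdx, lowerIdx, Finset.mem_filter,
    Finset.mem_univ, true_and]
  constructor
  · rintro h i ⟨l', hl'⟩ l ⟨i', hi'⟩
    -- The pairs that attain 4n form the full product `upperIdx × lowerIdx`: the differences (i,l)
    -- and (i',l') add up to 8n, and neither exceeds 4n.
    refine (h i l).2 (le_antisymm (hk i l) ?_)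
    have := hk i' l'
    linarith
  · exact fun h i l => ⟨hk i l, fun hil => h i ⟨l, hil⟩ l ⟨i, hil⟩⟩

lemma disjoint_upperIdx_lowerIdx {n : ℕ} (hn : 1 ≤ n) {k : Fin 3 → ℤ}
    (hk : k ∈ LambdaDagStar n) : Disjoint (upperIdx n k) (lowerIdx n k) := by
  rw [mem_LambdaDagStar_iff] at hk
  simp only [upperIdx, lowerIdx, Finset.disjoint_left, Finset.mem_filter, Finset.mem_univ,
    true_and]
  rintro i ⟨l, hl⟩ ⟨j, hj⟩
  have := hk j l
  omega

lemma mu_eq_sum {n : ℕ} (hn : 1 ≤ n) {k : Fin 3 → ℤ} (hk : k ∈ LambdaDagStar n) :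
    mu n k = 1 / 24 * ∑ σ : Equiv.Perm (Fin 4), if k ∈ halfOpen n σ then 1 else 0 := by
  have h := card_perm_mul_choose _ _ (disjoint_upperIdx_lowerIdx hn hk)
  simp only [Finset.sum_boole, mem_halfOpen_iff_lt hn hk]
  have h0 : ((upperIdx n k).card + (lowerIdx n k).card).choose (upperIdx n k).card ≠ 0 := by
    intro h0
    simp [h0] at h
  have h0' : ((((upperIdx n k).card + (lowerIdx n k).card).choose (upperIdx n k).card : ℕ) : ℂ)
      ≠ 0 := by exact_mod_cast h0
  have h' := congrArg (Nat.cast (R := ℂ)) h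
  push_cast at h'
  unfold mu
  field_simp
  rw [← h', mul_comm]

lemma sum_mu_mul {n : ℕ} (hn : 1 ≤ n) (F : (Fin 3 → ℤ) → ℂ) :
    ∑ k ∈ LambdaDagStar n, mu n k * F k =
      1 / 24 * ∑ σ : Equiv.Perm (Fin 4), ∑ k ∈ halfOpen n σ, F k := by
  have : ∀ σ : Equiv.Perm (Fin 4), ∑ k ∈ halfOpen n σ, F k =
      ∑ k ∈ LambdaDagStar n, if k ∈ halfOpen n σ then F k else 0 := by
    intro σ
    rw [← Finset.sum_filter]
    refine Finset.sum_congr ?_ fun _ _ => rfl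
    ext k
    simp [halfOpen]
  simp only [this]
  rw [Finset.sum_comm, Finset.mul_sum]
  refine Finset.sum_congr rfl fun k hk => ?_
  rw [mu_eq_sum hn hk, mul_assoc, Finset.sum_mul]
  simp

/-- The lattice `n D₃`. -/
def scaledD3 (n : ℕ) : AddSubgroup (Fin 3 → ℤ) where
  carrier := {v | ∃ d : Fin 3 → ℤ, Even (∑ i, d i) ∧ ∀ i, v i = n * d i}
  zero_mem' := ⟨0, by simp, by simp⟩
  add_mem' := by
    rintro a b ⟨d, hd, ha⟩ ⟨e, he, hb⟩
    refine ⟨d + e, ?_, fun i => ?_⟩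
    · simpa [Finset.sum_add_distrib] using hd.add he
    · simp [ha, hb, mul_add]
  neg_mem' := by
    rintro a ⟨d, hd, ha⟩
    exact ⟨-d, by simpa using hd, fun i => by simp [ha]⟩

/-- `A` contains exactly one representative of each coset of `L`. -/
def IsTransversal {G : Type*} [AddGroup G] (L : AddSubgroup G) (A : Finset G) : Prop :=
  ∀ x, ∃! a, a ∈ A ∧ a - x ∈ L

lemma IsTransversal.sum_eq {G M : Type*} [AddGroup G] [AddCommMonoid M] {L : AddSubgroup G}
    {A B : Finset G} (hA : IsTransversal L A) (hB : IsTransversal L B) (F : G → M)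
    (hF : ∀ x y, x - y ∈ L → F x = F y) : ∑ a ∈ A, F a = ∑ b ∈ B, F b := by
  choose f hf hf' using hA
  choose g hg hg' using hB
  have key : ∀ x y : G, x - y ∈ L → y - x ∈ L := fun x y h => by simpa using L.neg_mem h
  refine Finset.sum_nbij' g f (fun a _ => (hg a).1) (fun b _ => (hf b).1)
    (fun a ha => (hf' (g a) a ⟨ha, key _ _ (hg a).2⟩).symm)
    (fun b hb => (hg' (f b) b ⟨hb, key _ _ (hf b).2⟩).symm)
    (fun a _ => (hF _ _ (hg a).2).symm)

/-- Moving N from a coordinate to one that is more than N smaller lowers the sum of squares, so the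
process terminates. -/
lemma exists_spread_lt {N : ℤ} (hN : 0 < N) (t : Fin 4 → ℤ)
    (ht : ∀ i l, i ≠ l → ¬ N ∣ t i - t l) :
    ∃ m : Fin 4 → ℤ, ∑ i, m i = 0 ∧ ∀ i l, (t i + N * m i) - (t l + N * m l) < N := by
  induction hs : (∑ i, t i ^ 2).toNat using Nat.strong_induction_on generalizing t with
  | _ s ih =>
    by_cases h : ∀ i l, t i - t l < N
    · exact ⟨0, by simp, by simpa using h⟩
    push Not at h
    obtain ⟨i, l, hil⟩ := h
    have hne : i ≠ l := by
      rintro rfl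
      omega
    -- Non-divisibility excludes a gap of exactly N, for which the sum of squares would not drop.
    have hlt : N < t i - t l := lt_of_le_of_ne hil fun h => ht i l hne ⟨1, by omega⟩
    let e : Fin 4 → ℤ := Pi.single l 1 - Pi.single i 1
    have he : ∑ j, e j = 0 := by simp [e, Finset.sum_sub_distrib]
    have hsq : ∑ j, (t j + N * e j) ^ 2 = ∑ j, t j ^ 2 - 2 * N * (t i - t l) + 2 * N ^ 2 := by
      have h1 : ∑ j, e j ^ 2 = 2 := by
        have : ∀ j, e j ^ 2 = (Pi.single l 1 : Fin 4 → ℤ) j + (Pi.single i 1 : Fin 4 → ℤ) j := by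
          intro j
          by_cases hl : j = l <;> by_cases hi : j = i <;> simp_all [e]
        simp [this, Finset.sum_add_distrib]
      have h2 : ∑ j, t j * e j = t l - t i := by
        simp [e, mul_sub, Finset.sum_sub_distrib, Pi.single_apply]
      have h3 : ∀ j, (t j + N * e j) ^ 2 = t j ^ 2 + 2 * N * (t j * e j) + N ^ 2 * e j ^ 2 :=
        fun j => by ring
      simp only [h3, Finset.sum_add_distrib, ← Finset.mul_sum, h1, h2]
      ring
    have hpos : 0 ≤ ∑ j, (t j + N * e j) ^ 2 := Finset.sum_nonneg fun j _ => sq_nonneg _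
    have hdec : ∑ j, (t j + N * e j) ^ 2 < ∑ j, t j ^ 2 := by nlinarith
    obtain ⟨m, hm, hm'⟩ := ih _ (by omega) (fun j => t j + N * e j) (by
      intro a b hab hd
      apply ht a b hab
      have : t a - t b = (t a + N * e a - (t b + N * e b)) - N * (e a - e b) := by ring
      rw [this]
      exact dvd_sub hd (dvd_mul_right _ _)) rfl
    refine ⟨e + m, by simp [Finset.sum_add_distrib, he, hm], fun a b => ?_⟩
    have := hm' a b
    simp only [Pi.add_apply, mul_add]
    linarith

/-- A nonzero `m` of sum zero has a positive and a negative entry; the gap between these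
coordinates, initially above -N, grows by at least 2N. -/
lemma eq_zero_of_spread_lt {N : ℤ} (hN : 0 < N) {t m : Fin 4 → ℤ} (hm : ∑ i, m i = 0)
    (h : ∀ i l, t i - t l < N) (h' : ∀ i l, (t i + N * m i) - (t l + N * m l) < N) : m = 0 := by
  by_contra hne
  obtain ⟨j, hj⟩ := Function.ne_iff.1 hne
  obtain ⟨i, -, hi⟩ := Finset.exists_pos_of_sum_zero_of_exists_nonzero m hm
    ⟨j, Finset.mem_univ _, hj⟩
  obtain ⟨l, -, hl⟩ := Finset.exists_pos_of_sum_zero_of_exists_nonzero (fun i => - m i)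
    (by simpa using hm) ⟨j, Finset.mem_univ _, by simpa using hj⟩
  have h1 := h l i
  have h2 := h' i l
  nlinarith

/-- Modulo 4 the perturbed coordinates are the distinct labels `σ i`. -/
lemma not_dvd_perturbed_sub (n : ℕ) (σ : Equiv.Perm (Fin 4)) (k : Fin 3 → ℤ) (i l : Fin 4)
    (hil : i ≠ l) : ¬ (16 * n : ℤ) ∣ perturbed σ k i - perturbed σ k l := by
  rintro ⟨c, hc⟩
  have hi := (σ i).isLt
  have hl := (σ l).isLt
  have hne : (σ i : ℕ) ≠ σ l := fun h => hil (σ.injective (Fin.ext h))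
  unfold perturbed at hc
  rw [mul_assoc] at hc
  omega

/-- This is the isomorphism of D₃ with A₃: translations by nD₃ become translations by 4n times
integer vectors of sum zero. -/
lemma homog_add_sub (n : ℕ) (k d : Fin 3 → ℤ) (m : Fin 4 → ℤ) (hm : ∑ i, m i = 0)
    (h0 : d 0 = m 1 + m 2) (h1 : d 1 = m 0 + m 2) (h2 : d 2 = m 0 + m 1) (i : Fin 4) :
    homog (fun i => k i + n * d i) i = homog k i + 4 * n * m i := by
  rw [Fin.sum_univ_four] at hm
  have h3 : m 3 = - m 0 - m 1 - m 2 := by omega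
  fin_cases i <;> simp [homog, h0, h1, h2, h3] <;> ring

lemma isTransversal_halfOpen {n : ℕ} (hn : 1 ≤ n) (σ : Equiv.Perm (Fin 4)) :
    IsTransversal (scaledD3 n) (halfOpen n σ) := by
  intro x
  have hN : (0 : ℤ) < 16 * n := by omega
  obtain ⟨m, hm, hlt⟩ := exists_spread_lt hN (perturbed σ x) (not_dvd_perturbed_sub n σ x)
  apply existsUnique_of_exists_of_unique
  · let d : Fin 3 → ℤ := ![m 1 + m 2, m 0 + m 2, m 0 + m 1]
    have hh := homog_add_sub n x d m hm rfl rfl rfl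
    refine ⟨fun i => x i + n * d i, (mem_halfOpen_iff hn).2 fun i l => ?_, d, ?_, by simp⟩
    · have := hlt i l
      simp only [perturbed, hh] at this ⊢
      linarith
    · exact ⟨m 0 + m 1 + m 2, by simp [Fin.sum_univ_three, d]; ring⟩
  · rintro a b ⟨ha, hax⟩ ⟨hb, hbx⟩
    obtain ⟨d, ⟨r, hr⟩, hd⟩ : b - a ∈ scaledD3 n := by
      simpa using (scaledD3 n).sub_mem hbx hax
    rw [Fin.sum_univ_three] at hr
    have hba : b = fun i => a i + n * d i := by
      ext i
      have := hd i
      simp only [Pi.sub_apply] at this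
      linarith
    -- The inverse of D₃ ≅ A₃; halving the coordinate sum to `r` is where evenness is needed.
    let m : Fin 4 → ℤ := ![r - d 0, r - d 1, r - d 2, -r]
    have hm : ∑ i, m i = 0 := by simp [Fin.sum_univ_four, m]; linarith
    have hh := homog_add_sub n a d m hm (by simp [m]; linarith) (by simp [m]; linarith)
      (by simp [m]; linarith)
    rw [← hba] at hh
    rw [mem_halfOpen_iff hn] at ha hb
    have hm0 := eq_zero_of_spread_lt (m := m) hN hm ha fun i l => by
      have := hb i l
      simp only [perturbed, hh] at this ⊢
      linarith
    have e0 : r - d 0 = 0 := congrFun hm0 0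
    have e1 : r - d 1 = 0 := congrFun hm0 1
    have e2 : r - d 2 = 0 := congrFun hm0 2
    have e3 : -r = 0 := congrFun hm0 3
    have hd0 : d = 0 := by
      ext i
      fin_cases i <;> simp <;> omega
    simp [hba, hd0]

/-- The edge lengths of a box that is a fundamental domain of `n D₃`. -/
def boxLength (n : ℕ) : Fin 3 → ℕ := ![n, n, 2 * n]

/-- The integer points of a half-open box that is a fundamental domain of `n D₃`. -/
noncomputable def box (n : ℕ) : Finset (Fin 3 → ℤ) :=
  Fintype.piFinset fun i => Finset.Ico (0 : ℤ) (boxLength n i)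

lemma isTransversal_box {n : ℕ} (hn : 1 ≤ n) : IsTransversal (scaledD3 n) (box n) := by
  intro x
  have hn0 : (0 : ℤ) < n := by omega
  simp only [box, Fintype.mem_piFinset, Fin.forall_fin_succ, boxLength, Finset.mem_Ico]
  simp
  apply existsUnique_of_exists_of_unique
  · set p := x 0 / n with hp
    set q := x 1 / n with hq
    -- Shifting the third coordinate along with the first two keeps the coordinate sum of the
    -- translation even; what remains free is a multiple of 2n.
    set y := x 2 - n * (p + q) with hy
    set r := y / (2 * n) with hr
    refine ⟨![x 0 - n * p, x 1 - n * q, y - 2 * n * r], ?_, ![-p, -q, -(p + q) - 2 * r], ?_, ?_⟩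
    · have := Int.emod_nonneg (x 0) hn0.ne'
      have := Int.emod_lt_of_pos (x 0) hn0
      have := Int.emod_nonneg (x 1) hn0.ne'
      have := Int.emod_lt_of_pos (x 1) hn0
      have := Int.emod_nonneg y (b := 2 * n) (by omega)
      have := Int.emod_lt_of_pos y (b := 2 * n) (by omega)
      have := Int.mul_ediv_add_emod (x 0) n
      have := Int.mul_ediv_add_emod (x 1) n
      have := Int.mul_ediv_add_emod y (2 * n)
      simp
      refine ⟨⟨?_, ?_⟩, ⟨?_, ?_⟩, ?_, ?_⟩ <;> linarith
    · exact ⟨-(p + q) - r, by simp [Fin.sum_univ_three]; ring⟩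
    · intro i
      fin_cases i <;> simp [hy] <;> ring
  · rintro a b ⟨⟨⟨a0, a0'⟩, ⟨a1, a1'⟩, a2, a2'⟩, hax⟩ ⟨⟨⟨b0, b0'⟩, ⟨b1, b1'⟩, b2, b2'⟩, hbx⟩
    obtain ⟨d, ⟨r, hr⟩, hd⟩ : b - a ∈ scaledD3 n := by
      simpa using (scaledD3 n).sub_mem hbx hax
    have h0 := hd 0
    have h1 := hd 1
    have h2 := hd 2
    simp only [Pi.sub_apply] at h0 h1 h2
    rw [Fin.sum_univ_three] at hr
    have key : ∀ c : ℤ, n * c < n → -n < n * c → c = 0 := fun c hc hc' => by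
      have : c < 1 := by nlinarith
      have : -1 < c := by nlinarith
      omega
    have e0 := key (d 0) (by linarith) (by linarith)
    have e1 := key (d 1) (by linarith) (by linarith)
    have e2 : d 2 = 2 * r := by omega
    have e3 := key r (by rw [e2] at h2; linarith) (by rw [e2] at h2; linarith)
    rw [e3] at e2
    have hd0 : ∀ i, d i = 0 := by
      simp [Fin.forall_fin_succ, e0, e1, e2]
    ext i
    have := hd i
    rw [hd0 i, Pi.sub_apply] at this
    linarith

lemma sum_mu_mul_of_periodic {n : ℕ} (hn : 1 ≤ n) (F : (Fin 3 → ℤ) → ℂ)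
    (hF : ∀ x y, x - y ∈ scaledD3 n → F x = F y) :
    ∑ k ∈ LambdaDagStar n, mu n k * F k = ∑ k ∈ box n, F k := by
  rw [sum_mu_mul hn, Finset.sum_congr rfl fun σ _ =>
    (isTransversal_halfOpen hn σ).sum_eq (isTransversal_box hn) F hF]
  simp [Fintype.card_perm, Nat.factorial]

/-! ### Values of the kernel at the nodes -/

lemma sum_zpow_Ico {z : ℂ} {M : ℕ} (hz : z ^ M = 1) :
    ∑ v ∈ Finset.Ico (0 : ℤ) M, z ^ v = if z = 1 then (M : ℂ) else 0 := by
  have : ∑ v ∈ Finset.Ico (0 : ℤ) M, z ^ v = ∑ v ∈ Finset.range M, z ^ v := by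
    refine Finset.sum_nbij' Int.toNat (fun v => (v : ℤ)) ?_ ?_ ?_ ?_ ?_
    · intro a; simp; omega
    · intro a; simp
    · intro a; simp; omega
    · intro a; simp
    · intro a ha
      lift a to ℕ using (Finset.mem_Ico.1 ha).1
      simp
  rw [this]
  split_ifs with h
  · simp [h]
  · have := mul_geom_sum z M
    rw [hz, sub_self] at this
    exact (mul_eq_zero.1 this).resolve_left (sub_ne_zero.2 h)

/-- The root of unity `exp(π i a / n)`. -/
noncomputable def root (n : ℕ) (a : ℤ) : ℂ :=
  Complex.exp (2 * Real.pi * Complex.I * (a / (2 * n)))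

lemma root_zpow {n : ℕ} (a b : ℤ) :
    root n a ^ b = Complex.exp (2 * Real.pi * Complex.I * ((b * a : ℤ) / (2 * n))) := by
  rw [root, ← Complex.exp_int_mul]
  push_cast
  ring_nf

lemma exp_eq_one_iff_dvd {n : ℕ} (hn : 1 ≤ n) (a : ℤ) :
    Complex.exp (2 * Real.pi * Complex.I * (a / (2 * n))) = 1 ↔ (2 * n : ℤ) ∣ a := by
  have hn0 : (n : ℂ) ≠ 0 := by exact_mod_cast (by omega : n ≠ 0)
  have hI := Complex.two_pi_I_ne_zero
  rw [Complex.exp_eq_one_iff]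
  refine exists_congr fun c => ?_
  rw [mul_comm (c : ℂ), mul_right_inj' hI, div_eq_iff (by simpa using hn0)]
  constructor
  · intro h
    have : a = c * (2 * n) := by exact_mod_cast h
    linarith
  · intro h
    rw [h]
    push_cast
    ring

lemma root_zpow_eq_one_iff {n : ℕ} (hn : 1 ≤ n) (a b : ℤ) :
    root n a ^ b = 1 ↔ (2 * n : ℤ) ∣ b * a := by
  rw [root_zpow, exp_eq_one_iff_dvd hn]

lemma expo_eq_prod_root (n : ℕ) (k j : Fin 3 → ℤ) :
    expo k (fun i => (j i : ℝ) / (2 * n)) = ∏ i, root n (j i) ^ k i := by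
  simp only [root_zpow, ← Complex.exp_sum, expo]
  congr 1
  rw [Finset.mul_sum]
  refine Finset.sum_congr rfl fun i _ => ?_
  push_cast
  ring

/-- A frequency shift n·d changes the phase by d·j/2 turns, an integer when `d` has even sum and the
`j i` share a parity. -/
lemma expo_div_periodic {n : ℕ} (hn : 1 ≤ n) {j : Fin 3 → ℤ} (hj : ∀ i l, Even (j i - j l))
    {x y : Fin 3 → ℤ} (hxy : x - y ∈ scaledD3 n) :
    expo x (fun i => (j i : ℝ) / (2 * n)) = expo y (fun i => (j i : ℝ) / (2 * n)) := by
  obtain ⟨d, ⟨r, hr⟩, hd⟩ := hxy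
  have hroot : ∀ a, root n a ≠ 0 := fun a => Complex.exp_ne_zero _
  have hx : ∀ i, x i = y i + n * d i := fun i => by
    have := hd i
    simp only [Pi.sub_apply] at this
    linarith
  simp only [expo_eq_prod_root, hx, zpow_add₀ (hroot _), Finset.prod_mul_distrib]
  suffices h : ∏ i, root n (j i) ^ (n * d i) = 1 by rw [h, mul_one]
  simp only [root_zpow, ← Complex.exp_sum, ← Finset.mul_sum, ← Finset.sum_div]
  rw [← Int.cast_sum, exp_eq_one_iff_dvd hn]
  obtain ⟨s, hs⟩ := hj 0 2
  obtain ⟨t, ht⟩ := hj 1 2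
  rw [Fin.sum_univ_three] at hr ⊢
  refine ⟨d 0 * s + d 1 * t + r * j 2, ?_⟩
  have h0 : j 0 = s + s + j 2 := by linarith
  have h1 : j 1 = t + t + j 2 := by linarith
  have h2 : d 2 = r + r - d 0 - d 1 := by linarith
  rw [h0, h1, h2]
  ring

lemma PhiStar_div {n : ℕ} (hn : 1 ≤ n) {j : Fin 3 → ℤ} (hj : ∀ i l, Even (j i - j l)) :
    PhiStar n (fun i => (j i : ℝ) / (2 * n)) = if ∀ i, (2 * n : ℤ) ∣ j i then 1 else 0 := by
  have hn0 : (n : ℂ) ≠ 0 := by exact_mod_cast (by omega : n ≠ 0)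
  rw [PhiStar, sum_mu_mul_of_periodic hn _ fun x y => expo_div_periodic hn hj]
  simp only [expo_eq_prod_root, box]
  rw [← Finset.prod_univ_sum (fun i => Finset.Ico (0 : ℤ) (boxLength n i))
    (fun i v => root n (j i) ^ v)]
  have hone : ∀ i, root n (j i) = 1 ↔ (2 * n : ℤ) ∣ j i := fun i => by
    simpa using root_zpow_eq_one_iff hn (j i) 1
  have h2 : root n (j 2) ^ (2 * n) = 1 := by
    have := (root_zpow_eq_one_iff hn (j 2) ((2 * n : ℕ) : ℤ)).2 ⟨j 2, by push_cast; ring⟩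
    rwa [zpow_natCast] at this
  rw [Fin.prod_univ_three]
  simp only [boxLength, Matrix.cons_val]
  rw [sum_zpow_Ico h2]
  by_cases hd : (2 * n : ℤ) ∣ j 2
  -- The sums of length n need the n-th power of the root to be 1, that is, `j i` even. If `j 2` is
  -- divisible by 2n, parity supplies this; otherwise the factor of length 2n already vanishes.
  · have heven : ∀ i, root n (j i) ^ n = 1 := fun i => by
      have he : Even (j i) := by
        have := (hj i 2).add ((even_iff_two_dvd.2 (dvd_mul_right 2 (n : ℤ))).trans_dvd hd)
        simpa using this
      obtain ⟨r, hr⟩ := he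
      have := (root_zpow_eq_one_iff hn (j i) (n : ℤ)).2 ⟨r, by rw [hr]; ring⟩
      rwa [zpow_natCast] at this
    rw [sum_zpow_Ico (heven 0), sum_zpow_Ico (heven 1)]
    simp only [hone, Fin.forall_fin_succ]
    by_cases h0 : (2 * n : ℤ) ∣ j 0 <;> by_cases h1 : (2 * n : ℤ) ∣ j 1 <;>
      simp [h0, h1, hd]
    field_simp
  · have : root n (j 2) ≠ 1 := fun h => hd ((hone 2).1 h)
    rw [if_neg this, if_neg fun h => hd (h 2)]
    simp

/-! ### Symmetry and periodicity of the fundamental functions -/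

lemma expo_add (k : Fin 3 → ℤ) (x y : Fin 3 → ℝ) :
    expo k (fun i => x i + y i) = expo k x * expo k y := by
  rw [expo, expo, expo, ← Complex.exp_add, ← mul_add, ← Finset.sum_add_distrib]
  push_cast
  simp only [mul_add]

lemma expo_intCast (k m : Fin 3 → ℤ) : expo k (fun i => (m i : ℝ)) = 1 := by
  rw [expo, Complex.exp_eq_one_iff]
  refine ⟨∑ i, k i * m i, ?_⟩
  push_cast
  ring

lemma PhiStar_add_int (n : ℕ) (x : Fin 3 → ℝ) (m : Fin 3 → ℤ) :
    PhiStar n (fun i => x i + m i) = PhiStar n x := by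
  simp only [PhiStar, expo_add, expo_intCast, mul_one]

lemma symm_congr_of_sign {f : (Fin 3 → ℝ) → ℂ} (hf : ∀ x (m : Fin 3 → ℤ),
    f (fun i => x i + m i) = f x) {x y : Fin 3 → ℝ} {e m : Fin 3 → ℤ}
    (he : ∀ i, e i = -1 ∨ e i = 1) (hy : ∀ i, y i = e i * x i + m i) :
    symm f y = symm f x := by
  have hee : ∀ i, e i * e i = 1 := fun i => by rcases he i with h | h <;> simp [h]
  have hmem : ∀ d ∈ Fintype.piFinset (fun _ : Fin 3 => ({-1, 1} : Finset ℤ)),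
      (fun i => d i * e i) ∈ Fintype.piFinset (fun _ : Fin 3 => ({-1, 1} : Finset ℤ)) := by
    intro d hd
    simp only [Fintype.mem_piFinset, Finset.mem_insert, Finset.mem_singleton] at hd ⊢
    intro i
    rcases he i with h | h <;> rcases hd i with h' | h' <;> simp [h, h']
  unfold symm
  congr 1
  refine Finset.sum_nbij' (fun d i => d i * e i) (fun d i => d i * e i) hmem hmem
    (fun d _ => by ext i; simp [mul_assoc, hee]) (fun d _ => by ext i; simp [mul_assoc, hee])
    fun d _ => ?_
  -- After the reindexing d ↦ d·e the arguments differ by the integer vector d·m.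
  refine Eq.trans ?_ (hf _ fun i => d i * m i)
  congr 1
  ext i
  rw [hy]
  push_cast
  ring

lemma ell_eq_of_cos_eq (n : ℕ) (k : Fin 3 → ℤ) {x y : Fin 3 → ℝ}
    (h : ∀ i, Real.cos (2 * Real.pi * x i) = Real.cos (2 * Real.pi * y i)) :
    ell n k y = ell n k x := by
  have key : ∀ i, ∃ e m : ℤ, (e = -1 ∨ e = 1) ∧ y i = e * x i + m := by
    intro i
    obtain ⟨m, hm | hm⟩ := Real.cos_eq_cos_iff.1 (h i)
    · refine ⟨1, m, Or.inr rfl, mul_left_cancel₀ Real.two_pi_pos.ne' ?_⟩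
      rw [hm]
      push_cast
      ring
    · refine ⟨-1, m, Or.inl rfl, mul_left_cancel₀ Real.two_pi_pos.ne' ?_⟩
      rw [hm]
      push_cast
      ring
  choose e m he hy using key
  unfold ell
  rw [symm_congr_of_sign (fun x m => ?_) he hy]
  refine Eq.trans ?_ (PhiStar_add_int n _ m)
  simp only [add_sub_right_comm]

lemma ellStar_cos (n : ℕ) (k : Fin 3 → ℤ) (x : Fin 3 → ℝ) :
    ellStar n k (fun i => Real.cos (2 * Real.pi * x i)) = ell n k x := by
  refine ell_eq_of_cos_eq n k fun i => ?_
  rw [mul_div_cancel₀ _ Real.two_pi_pos.ne',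
    Real.cos_arccos (Real.neg_one_le_cos _) (Real.cos_le_one _)]

/-! ### Interpolation at the nodes -/

lemma bounds_and_parity_of_mem_Xi {n : ℕ} {k : Fin 3 → ℤ} (hk : k ∈ Xi n) :
    (∀ i, 0 ≤ k i ∧ k i ≤ n) ∧ ∀ i l, Even (k i - k l) := by
  simp only [Xi, Finset.mem_union, Finset.mem_image, Fintype.mem_piFinset, Finset.mem_Icc] at hk
  rcases hk with ⟨a, ha, rfl⟩ | ⟨a, ha, rfl⟩
  · refine ⟨fun i => ?_, fun i l => ⟨a i - a l, by ring⟩⟩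
    have := ha i
    dsimp only
    omega
  · refine ⟨fun i => ?_, fun i l => ⟨a i - a l, by ring⟩⟩
    have := ha i
    dsimp only
    omega

lemma lam_eq_prod (n : ℕ) (k : Fin 3 → ℤ) :
    lam n k = ∏ i, if 0 < k i ∧ k i < n then 2 else 1 := by
  rw [lam, Finset.prod_ite]
  simp

/-- At an endpoint a = 0 or a = n both signs hit the same class modulo 2n, inside only one does. The
coordinate factor of `lam` evens this out to 2, and the three factors 2 cancel the 1/8 in `symm`. -/
lemma sum_sign_dvd {n : ℕ} (hn : 1 ≤ n) {a b : ℤ} (ha : 0 ≤ a ∧ a ≤ n) (hb : 0 ≤ b ∧ b ≤ n) :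
    (if 0 < a ∧ a < n then 2 else 1) *
      ∑ e ∈ ({-1, 1} : Finset ℤ), (if (2 * n : ℤ) ∣ e * b - a then (1 : ℂ) else 0) =
      if b = a then 2 else 0 := by
  have hsmall : ∀ {c : ℤ}, (2 * n : ℤ) ∣ c → |c| < 2 * n → c = 0 := fun h h' =>
    Int.eq_zero_of_abs_lt_dvd h h'
  have h1 : (2 * n : ℤ) ∣ 1 * b - a ↔ b = a := by
    constructor
    · intro h
      have := hsmall h (by rw [abs_lt]; omega)
      omega
    · rintro rfl
      simp
  have h2 : (2 * n : ℤ) ∣ -1 * b - a ↔ b = a ∧ ¬ (0 < a ∧ a < n) := by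
    constructor
    · intro h
      have h' : (2 * n : ℤ) ∣ a + b := by
        have : a + b = -(-1 * b - a) := by ring
        rw [this]
        exact dvd_neg.2 h
      by_cases hab : a + b = 2 * n
      · omega
      · have := hsmall h' (by rw [abs_lt]; omega)
        omega
    · rintro ⟨rfl, hb'⟩
      rcases (by omega : b = 0 ∨ b = n) with h | h
      · simp [h]
      · exact ⟨-1, by rw [h]; ring⟩
  rw [Finset.sum_pair (by norm_num), if_congr h1 rfl rfl, if_congr h2 rfl rfl]
  by_cases hab : b = a <;> by_cases hin : 0 < a ∧ a < n <;> simp [hab, hin]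
  norm_num

lemma ell_div {n : ℕ} (hn : 1 ≤ n) {k j : Fin 3 → ℤ} (hk : k ∈ Xi n) (hj : j ∈ Xi n) :
    ell n k (fun i => (j i : ℝ) / (2 * n)) = if j = k then 1 else 0 := by
  obtain ⟨hk, hk'⟩ := bounds_and_parity_of_mem_Xi hk
  obtain ⟨hj, hj'⟩ := bounds_and_parity_of_mem_Xi hj
  have key : ∀ e ∈ Fintype.piFinset (fun _ : Fin 3 => ({-1, 1} : Finset ℤ)),
      PhiStar n (fun i => (e i : ℝ) * ((j i : ℝ) / (2 * n)) - (k i : ℝ) / (2 * n)) =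
        ∏ i, if (2 * n : ℤ) ∣ e i * j i - k i then (1 : ℂ) else 0 := by
    intro e he
    simp only [Fintype.mem_piFinset, Finset.mem_insert, Finset.mem_singleton] at he
    -- Sign changes preserve parity, so the differences of two nodes again have coordinates of one
    -- parity.
    have h := PhiStar_div hn (j := fun i => e i * j i - k i) fun i l => by
      have h1 := hk' i l
      have h2 := hj' i l
      rw [Int.even_sub] at h1 h2
      rcases he i with hi | hi <;> rcases he l with hl | hl <;>
        simp [hi, hl, Int.even_sub, h1, h2]
    rw [Finset.prod_ite_zero, Finset.prod_const_one]
    simp only [Finset.mem_univ, true_implies]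
    rw [← h]
    congr 1
    ext i
    push_cast
    ring
  rw [ell, symm, Finset.sum_congr rfl key, ← Finset.prod_univ_sum (fun _ => ({-1, 1} : Finset ℤ))
    (fun i e => if (2 * n : ℤ) ∣ e * j i - k i then (1 : ℂ) else 0), mul_left_comm, lam_eq_prod,
    ← Finset.prod_mul_distrib, Finset.prod_congr rfl fun i _ => sum_sign_dvd hn (hk i) (hj i),
    Finset.prod_ite_zero]
  by_cases h : j = k
  · subst h
    simp
    norm_num
  · rw [if_neg h, if_neg fun h' => h (funext fun i => h' i (Finset.mem_univ i))]
    simp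

lemma node_eq {n : ℕ} (hn : 1 ≤ n) (k : Fin 3 → ℤ) :
    node n k = fun i => Real.cos (2 * Real.pi * ((k i : ℝ) / (2 * n))) := by
  have hn0 : (n : ℝ) ≠ 0 := by exact_mod_cast (by omega : n ≠ 0)
  ext i
  rw [node]
  congr 1
  field_simp

lemma interp_node {n : ℕ} (hn : 1 ≤ n) (f : (Fin 3 → ℝ) → ℂ) {k : Fin 3 → ℤ} (hk : k ∈ Xi n) :
    interp n f (node n k) = f (node n k) := by
  unfold interp
  rw [Finset.sum_eq_single_of_mem k hk]
  · nth_rewrite 2 [node_eq hn]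
    rw [ellStar_cos, ell_div hn hk hk, if_pos rfl, mul_one]
  · intro j hj hjk
    nth_rewrite 2 [node_eq hn]
    rw [ellStar_cos, ell_div hn hj hk, if_neg hjk.symm, mul_zero]

/-! ### The number of nodes -/

lemma node_injOn {n : ℕ} (hn : 1 ≤ n) : Set.InjOn (node n) (Xi n : Set (Fin 3 → ℤ)) := by
  intro k hk j hj h
  have hn0 : (0 : ℝ) < n := by exact_mod_cast hn
  have hmem : ∀ {l}, l ∈ Xi n → ∀ i, (l i : ℝ) * Real.pi / n ∈ Set.Icc 0 Real.pi := by
    intro l hl i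
    obtain ⟨h0, h1⟩ := (bounds_and_parity_of_mem_Xi hl).1 i
    have h0' : (0 : ℝ) ≤ l i := by exact_mod_cast h0
    have h1' : (l i : ℝ) ≤ n := by exact_mod_cast h1
    refine ⟨by positivity, ?_⟩
    rw [div_le_iff₀ hn0, mul_comm]
    gcongr
  ext i
  have := Real.injOn_cos (hmem hk i) (hmem hj i) (congrFun h i)
  field_simp at this
  exact_mod_cast this

lemma card_Xi {n : ℕ} (hn : 1 ≤ n) :
    (Xi n).card = (n / 2 + 1) ^ 3 + ((n - 1) / 2 + 1) ^ 3 := by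
  rw [Xi, Finset.card_union_of_disjoint, Finset.card_image_of_injective,
    Finset.card_image_of_injective, Fintype.card_piFinset_const, Fintype.card_piFinset_const]
  · simp only [Int.card_Icc]
    congr 2 <;> omega
  · intro a b h
    ext i
    have := congrFun h i
    simp only at this
    omega
  · intro a b h
    ext i
    have := congrFun h i
    simp only at this
    omega
  · rw [Finset.disjoint_left]
    simp only [Finset.mem_image, not_exists, not_and]
    rintro _ ⟨a, -, rfl⟩ b - h
    have := congrFun h 0
    omega

lemma ncard_Gamma {n : ℕ} (hn : 1 ≤ n) :
    (Gamma n).ncard = (n / 2 + 1) ^ 3 + ((n - 1) / 2 + 1) ^ 3 := by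
  rw [Gamma, (node_injOn hn).ncard_image, Set.ncard_coe_finset, card_Xi hn]

/-! ### The fundamental functions are real -/

lemma homog_neg (k : Fin 3 → ℤ) (i : Fin 4) : homog (-k) i = -homog k i := by
  fin_cases i <;> simp [homog] <;> ring

lemma upperIdx_neg (n : ℕ) (k : Fin 3 → ℤ) : upperIdx n (-k) = lowerIdx n k := by
  simp only [upperIdx, lowerIdx, homog_neg, neg_sub_neg]

lemma mu_neg (n : ℕ) (k : Fin 3 → ℤ) : mu n (-k) = mu n k := by
  have h := upperIdx_neg n k
  have h' : lowerIdx n (-k) = upperIdx n k := by rw [← upperIdx_neg, neg_neg]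
  rw [mu, mu, h, h', add_comm, Nat.choose_symm_add]

lemma neg_mem_LambdaDagStar {n : ℕ} {k : Fin 3 → ℤ} (hk : k ∈ LambdaDagStar n) :
    -k ∈ LambdaDagStar n := by
  rw [mem_LambdaDagStar_iff] at hk ⊢
  intro i l
  have := hk l i
  simp only [homog_neg]
  linarith

lemma conj_expo (k : Fin 3 → ℤ) (x : Fin 3 → ℝ) :
    (starRingEnd ℂ) (expo k x) = expo (-k) x := by
  rw [expo, expo, ← Complex.exp_conj]
  simp [map_ofNat]

lemma conj_PhiStar (n : ℕ) (x : Fin 3 → ℝ) :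
    (starRingEnd ℂ) (PhiStar n x) = PhiStar n x := by
  simp only [PhiStar, map_mul, map_sum, conj_expo]
  have hmu : ∀ k, (starRingEnd ℂ) (mu n k) = mu n k := fun k => by simp [mu]
  have hc : (starRingEnd ℂ) (1 / (2 * (n : ℂ) ^ 3)) = 1 / (2 * (n : ℂ) ^ 3) := by simp [map_ofNat]
  rw [hc]
  congr 1
  refine Finset.sum_nbij' (fun k => -k) (fun k => -k) (fun _ => neg_mem_LambdaDagStar)
    (fun _ => neg_mem_LambdaDagStar) (fun _ _ => neg_neg _) (fun _ _ => neg_neg _) fun k _ => ?_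
  rw [hmu, mu_neg]

lemma ofReal_re_ell (n : ℕ) (k : Fin 3 → ℤ) (x : Fin 3 → ℝ) :
    (((ell n k x).re : ℝ) : ℂ) = ell n k x := by
  rw [← Complex.conj_eq_iff_re]
  simp [ell, symm, lam, conj_PhiStar, map_ofNat]

/-! ### The fundamental functions are polynomials -/

lemma symm_expo (k : Fin 3 → ℤ) (x : Fin 3 → ℝ) :
    symm (expo k) x = ((∏ i, Real.cos (k i * (2 * Real.pi * x i)) : ℝ) : ℂ) := by
  have h : ∀ e : Fin 3 → ℤ, expo k (fun i => (e i : ℝ) * x i) =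
      ∏ i, Complex.exp (e i * (k i * (2 * Real.pi * x i)) * Complex.I) := by
    intro e
    rw [expo, ← Complex.exp_sum, Finset.mul_sum]
    congr 1
    refine Finset.sum_congr rfl fun i _ => ?_
    push_cast
    ring
  simp only [symm, h]
  rw [← Finset.prod_univ_sum (fun _ => ({-1, 1} : Finset ℤ))
    (fun i e => Complex.exp (e * (k i * (2 * Real.pi * x i)) * Complex.I))]
  have h2 : ∀ i, ∑ e ∈ ({-1, 1} : Finset ℤ),
      Complex.exp (e * (k i * (2 * Real.pi * x i)) * Complex.I) =
        2 * Complex.cos (k i * (2 * Real.pi * x i)) := by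
    intro i
    rw [Finset.sum_pair (by norm_num), Complex.two_cos]
    push_cast
    rw [add_comm]
    simp
  simp only [h2, Finset.prod_mul_distrib]
  push_cast
  norm_num
  ring

lemma ell_eq_sum (n : ℕ) (k : Fin 3 → ℤ) (x : Fin 3 → ℝ) :
    ell n k x = ∑ v ∈ LambdaDagStar n,
      (lam n k * (1 / (2 * (n : ℂ) ^ 3)) * mu n v * expo v (fun i => -((k i : ℝ) / (2 * n)))) *
        ((∏ i, Real.cos (v i * (2 * Real.pi * x i)) : ℝ) : ℂ) := by
  simp only [← symm_expo, ell, symm, PhiStar, sub_eq_add_neg, expo_add, Finset.mul_sum]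
  rw [Finset.sum_comm]
  refine Finset.sum_congr rfl fun v _ => Finset.sum_congr rfl fun e _ => ?_
  ring

lemma prod_aeval_X_mem_PiStar {R : Type*} [CommRing R] {n : ℕ} {p : Fin 3 → Polynomial R}
    (hp : ∀ i j, i < j → (p i).natDegree + (p j).natDegree ≤ n) :
    ∏ i, Polynomial.aeval (MvPolynomial.X i : MvPolynomial (Fin 3) R) (p i) ∈ PiStar R n := by
  simp only [Polynomial.aeval_eq_sum_range]
  rw [Finset.prod_univ_sum]
  refine Submodule.sum_mem _ fun m hm => ?_
  have hle : ∀ i, m i ≤ (p i).natDegree := fun i => by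
    have := Fintype.mem_piFinset.1 hm i
    simpa [Nat.lt_succ_iff] using this
  have : ∏ i, (p i).coeff (m i) • (MvPolynomial.X i : MvPolynomial (Fin 3) R) ^ m i =
      (∏ i, (p i).coeff (m i)) • MvPolynomial.monomial (Finsupp.equivFunOnFinite.symm m) 1 := by
    rw [Finset.prod_smul, MvPolynomial.monomial_eq, Finsupp.prod_fintype _ _ (by simp)]
    simp
  rw [this]
  refine Submodule.smul_mem _ _ (Submodule.subset_span ⟨_, fun i j hij => ?_, rfl⟩)
  exact (add_le_add (hle i) (hle j)).trans (hp i j hij)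

/-- The product `T_{k₁}(s₁) T_{k₂}(s₂) T_{k₃}(s₃)` of Chebyshev polynomials. -/
noncomputable def chebyshevProd (k : Fin 3 → ℤ) : MvPolynomial (Fin 3) ℝ :=
  ∏ i, Polynomial.aeval (MvPolynomial.X i) (Polynomial.Chebyshev.T ℝ (k i))

lemma chebyshevProd_mem {n : ℕ} {k : Fin 3 → ℤ} (hk : k ∈ LambdaDagStar n) :
    chebyshevProd k ∈ PiStar ℝ n := by
  refine prod_aeval_X_mem_PiStar fun i j hij => ?_
  have h := (Finset.mem_filter.1 hk).2 i j hij
  rw [Polynomial.Chebyshev.natDegree_T, Polynomial.Chebyshev.natDegree_T]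
  omega

lemma eval_cos_chebyshevProd (k : Fin 3 → ℤ) (θ : Fin 3 → ℝ) :
    MvPolynomial.eval (fun i => Real.cos (θ i)) (chebyshevProd k) =
      ∏ i, Real.cos (k i * θ i) := by
  rw [chebyshevProd, map_prod]
  refine Finset.prod_congr rfl fun i _ => ?_
  rw [← Polynomial.Chebyshev.T_real_cos, ← MvPolynomial.coe_aeval_eq_eval, RingHom.coe_coe,
    ← Polynomial.aeval_algHom_apply, MvPolynomial.aeval_X, Polynomial.coe_aeval_eq_eval]

lemma exists_ellStar_eq_eval (n : ℕ) (k : Fin 3 → ℤ) :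
    ∃ p ∈ PiStar ℝ n, ∀ s : Fin 3 → ℝ, (∀ i, s i ∈ Set.Icc (-1 : ℝ) 1) →
      ellStar n k s = ((MvPolynomial.eval s p : ℝ) : ℂ) := by
  let c : (Fin 3 → ℤ) → ℂ := fun v =>
    lam n k * (1 / (2 * (n : ℂ) ^ 3)) * mu n v * expo v (fun i => -((k i : ℝ) / (2 * n)))
  -- The coefficients `c v` may be complex, but the whole sum and each cosine product are real, so
  -- only the real parts of the `c v` matter.
  refine ⟨∑ v ∈ LambdaDagStar n, (c v).re • chebyshevProd v,
    Submodule.sum_mem _ fun v hv => Submodule.smul_mem _ _ (chebyshevProd_mem hv),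
    fun s hs => ?_⟩
  have hs' : s = fun i => Real.cos (2 * Real.pi * (Real.arccos (s i) / (2 * Real.pi))) := by
    ext i
    rw [mul_div_cancel₀ _ Real.two_pi_pos.ne', Real.cos_arccos (hs i).1 (hs i).2]
  rw [hs', ellStar_cos, ← ofReal_re_ell, ell_eq_sum, Complex.re_sum, map_sum]
  congr 1
  refine Finset.sum_congr rfl fun v _ => ?_
  rw [Complex.re_mul_ofReal, MvPolynomial.smul_eval, eval_cos_chebyshevProd]

lemma exists_interp_eq_eval (n : ℕ) (f : (Fin 3 → ℝ) → ℝ) :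
    ∃ p ∈ PiStar ℝ n, ∀ s : Fin 3 → ℝ, (∀ i, s i ∈ Set.Icc (-1 : ℝ) 1) →
      interp n (fun t => (f t : ℂ)) s = ((MvPolynomial.eval s p : ℝ) : ℂ) := by
  choose p hp hp' using exists_ellStar_eq_eval n
  refine ⟨∑ k ∈ Xi n, f (node n k) • p k,
    Submodule.sum_mem _ fun k _ => Submodule.smul_mem _ _ (hp k), fun s hs => ?_⟩
  rw [interp, map_sum, Complex.ofReal_sum]
  refine Finset.sum_congr rfl fun k _ => ?_
  rw [hp' k s hs, MvPolynomial.smul_eval, Complex.ofReal_mul]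

lemma map_mem_PiStar {n : ℕ} {p : MvPolynomial (Fin 3) ℝ} (hp : p ∈ PiStar ℝ n) :
    MvPolynomial.map Complex.ofRealHom p ∈ PiStar ℂ n := by
  induction hp using Submodule.span_induction with
  | mem p hp =>
    obtain ⟨m, hm, rfl⟩ := hp
    exact Submodule.subset_span ⟨m, hm, by simp⟩
  | zero => simp
  | add p q _ _ hp hq => simpa using add_mem hp hq
  | smul a p _ hp =>
    rw [MvPolynomial.smul_eq_C_mul, map_mul, MvPolynomial.map_C, ← MvPolynomial.smul_eq_C_mul]
    exact Submodule.smul_mem _ _ hp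

lemma eval_map_ofReal (s : Fin 3 → ℝ) (p : MvPolynomial (Fin 3) ℝ) :
    MvPolynomial.eval (fun i => (s i : ℂ)) (MvPolynomial.map Complex.ofRealHom p) =
      ((MvPolynomial.eval s p : ℝ) : ℂ) := by
  exact (MvPolynomial.map_eval Complex.ofRealHom s p).symm

lemma exists_interp_eq_eval_complex (n : ℕ) (f : (Fin 3 → ℝ) → ℂ) :
    ∃ p ∈ PiStar ℂ n, ∀ s : Fin 3 → ℝ, (∀ i, s i ∈ Set.Icc (-1 : ℝ) 1) →
      interp n f s = MvPolynomial.eval (fun i => (s i : ℂ)) p := by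
  choose p hp hp' using exists_ellStar_eq_eval n
  refine ⟨∑ k ∈ Xi n, f (node n k) • MvPolynomial.map Complex.ofRealHom (p k),
    Submodule.sum_mem _ fun k _ => Submodule.smul_mem _ _ (map_mem_PiStar (hp k)),
    fun s hs => ?_⟩
  rw [interp, map_sum]
  refine Finset.sum_congr rfl fun k _ => ?_
  rw [hp' k s hs, MvPolynomial.smul_eval, eval_map_ofReal]

end CubeInterp

theorem mainTheorem4 (n : ℕ) (hn : 1 ≤ n) :
    -- the nodes are pairwise distinct and their number is as stated
    (CubeInterp.Gamma n).ncard = (n / 2 + 1) ^ 3 + ((n - 1) / 2 + 1) ^ 3 ∧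
    -- `ℓ_k^*(s) = ℓ_k(x)` for every `x` with `s = cos 2πx`
    (∀ k ∈ CubeInterp.Xi n, ∀ x : Fin 3 → ℝ,
      CubeInterp.ellStar n k (fun i => Real.cos (2 * Real.pi * x i)) = CubeInterp.ell n k x) ∧
    -- `L_n f` belongs to `Π_n^*` and interpolates `f` on `Γ_n`
    (∀ f : (Fin 3 → ℝ) → ℂ,
      (∃ p ∈ CubeInterp.PiStar ℂ n, ∀ s : Fin 3 → ℝ, (∀ i, s i ∈ Set.Icc (-1 : ℝ) 1) →
        CubeInterp.interp n f s = MvPolynomial.eval (fun i => (s i : ℂ)) p) ∧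
      (∀ z ∈ CubeInterp.Gamma n, CubeInterp.interp n f z = f z)) ∧
    -- for real `f` the polynomial is real
    (∀ f : (Fin 3 → ℝ) → ℝ,
      ∃ p ∈ CubeInterp.PiStar ℝ n, ∀ s : Fin 3 → ℝ, (∀ i, s i ∈ Set.Icc (-1 : ℝ) 1) →
        CubeInterp.interp n (fun t => (f t : ℂ)) s = ((MvPolynomial.eval s p : ℝ) : ℂ)) := by
  refine ⟨CubeInterp.ncard_Gamma hn, fun k _ x => CubeInterp.ellStar_cos n k x, fun f =>
    ⟨CubeInterp.exists_interp_eq_eval_complex n f, ?_⟩, CubeInterp.exists_interp_eq_eval n⟩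
  rintro _ ⟨k, hk, rfl⟩
  exact CubeInterp.interp_node hn f hk
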